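/- Let $d\ge 1$ and let $\Omega\subset\mathbb{R}^d$ be a smooth domain (a nonempty connected open set with $C^\infty$ boundary). For $m>0$, $1<p<\infty$, $\tau>0$, an integer $N\ge 1$ and $F^1,\dots,F^N\in L^p(\Omega)$, consider the solutions $\Psi^0,\dots,\Psi^{N-1}\in W^{2,p}(\Omega)$, $\Psi^N=0$, of $$ \frac{\Psi^{k+1}-\Psi^k}{\tau}+m\Delta\Psi^k=F^{k+1}\ \text{ in }\Omega,\qquad \partial_n\Psi^k=0\ \text{ on }\partial\Omega,\qquad 0\le k\le N-1, $$ where $\partial_n\Psi^k=0$ means $\int_\Omega\nabla\Psi^k\cdot\nabla\varphi=-\int_\Omega\Delta\Psi^k\,\varphi$ for all $\varphi\in W^{1,p'}(\Omega)$, $\frac1p+\frac1{p'}=1$. Let $K_{m,p}\in[0,\infty]$ be the discrete maximal regularity constant of $\Omega$, that is, the infimum of all finite $C\geq 0$ such that $$ \left(\sum_{k=0}^{N-1}\tau\|\Delta\Psi^k\|_{L^p(\Omega)}^p\right)^{1/p}\le C\left(\sum_{k=0}^{N-1}\tau\|F^{k+1}\|_{L^p(\Omega)}^p\right)^{1/p}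 $$ for all $\tau>0$, all $N$, all $F^1,\dots,F^N\in L^p(\Omega)$ and all such solutions ($K_{m,p}=\infty$ if there is no such $C$). Then, for all $m>0$ and $1<p<\infty$, $$ K_{m,p}=\frac{K_{1,p}}{m},\qquad\text{and}\qquad K_{m,2}=\frac1m . $$ Moreover, for $p=2$, the value $1/m$ is the best constant for each fixed $\tau>0$ and each fixed $N\ge1$ (in particular for $N=1$): for such $\tau$ and $N$, and $C\ge0$, the inequality above holds for all $F^1,\dots,F^N\in L^2(\Omega)$ and all such solutions if and only if $C\ge 1/m$. -/

import Mathlib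

open MeasureTheory
open scoped ContDiff NNReal ENNReal

/-- A smooth domain of `ℝ^d`: a nonempty connected open set whose boundary is `C^∞`, that is, near
each boundary point the set is `{ρ < 0}` for a smooth `ρ` that vanishes at the point and has a
nonzero differential there. -/
structure IsSmoothDomain {d : ℕ} (Ω : Set (EuclideanSpace ℝ (Fin d))) : Prop where
  isOpen : IsOpen Ω
  isConnected : IsConnected Ω
  smooth_boundary : ∀ x ∈ frontier Ω, ∃ U : Set (EuclideanSpace ℝ (Fin d)),
    ∃ ρ : EuclideanSpace ℝ (Fin d) → ℝ,
      IsOpen U ∧ x ∈ U ∧ ContDiff ℝ ∞ ρ ∧ ρ x = 0 ∧ fderiv ℝ ρ x ≠ 0 ∧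
        Ω ∩ U = {y | ρ y < 0} ∩ U

/-- `g` is the weak partial derivative `∂ᵢ u` in the open set `Ω` (only used below for `u`, `g` in
some `L^p(Ω)`, so that both integrals converge). -/
def HasWeakPartial {d : ℕ} (Ω : Set (EuclideanSpace ℝ (Fin d))) (i : Fin d)
    (u g : EuclideanSpace ℝ (Fin d) → ℝ) : Prop :=
  ∀ φ : EuclideanSpace ℝ (Fin d) → ℝ, ContDiff ℝ ∞ φ → HasCompactSupport φ → tsupport φ ⊆ Ω →
    ∫ x in Ω, u x * fderiv ℝ φ x (EuclideanSpace.single i 1) = -∫ x in Ω, g x * φ x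

/-- `u ∈ W^{1,p}(Ω)` with weak gradient `Du`. -/
structure MemW1p {d : ℕ} (Ω : Set (EuclideanSpace ℝ (Fin d))) (p : ℝ)
    (u : EuclideanSpace ℝ (Fin d) → ℝ) (Du : Fin d → EuclideanSpace ℝ (Fin d) → ℝ) : Prop where
  memLp : MemLp u (ENNReal.ofReal p) (volume.restrict Ω)
  memLp_partial : ∀ i, MemLp (Du i) (ENNReal.ofReal p) (volume.restrict Ω)
  hasWeakPartial : ∀ i, HasWeakPartial Ω i u (Du i)

/-- `u ∈ W^{2,p}(Ω)` with weak gradient `Du` and weak Hessian `D2u` (`D2u i j = ∂ⱼ ∂ᵢ u`). -/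
structure MemW2p {d : ℕ} (Ω : Set (EuclideanSpace ℝ (Fin d))) (p : ℝ)
    (u : EuclideanSpace ℝ (Fin d) → ℝ) (Du : Fin d → EuclideanSpace ℝ (Fin d) → ℝ)
    (D2u : Fin d → Fin d → EuclideanSpace ℝ (Fin d) → ℝ) : Prop where
  memW1p : MemW1p Ω p u Du
  memW1p_partial : ∀ i, MemW1p Ω p (Du i) (D2u i)

/-- `u ∈ W^{2,p}(Ω)`, `Δ u = g` in `Ω`, and `∂ₙ u = 0` on `∂Ω`. The homogeneous Neumann condition
is expressed by Green's formula `∫_Ω ∇u · ∇φ = - ∫_Ω (Δ u) φ` for all `φ ∈ W^{1,p'}(Ω)`,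
`1/p + 1/p' = 1`: the boundary term `∫_∂Ω (∂ₙ u) φ` vanishes for every such `φ`. -/
def HasNeumannLaplacian {d : ℕ} (Ω : Set (EuclideanSpace ℝ (Fin d))) (p : ℝ)
    (u g : EuclideanSpace ℝ (Fin d) → ℝ) : Prop :=
  ∃ (Du : Fin d → EuclideanSpace ℝ (Fin d) → ℝ)
    (D2u : Fin d → Fin d → EuclideanSpace ℝ (Fin d) → ℝ),
    MemW2p Ω p u Du D2u ∧
    (∀ᵐ x ∂volume.restrict Ω, g x = ∑ i, D2u i i x) ∧
    ∀ (φ : EuclideanSpace ℝ (Fin d) → ℝ) (Dφ : Fin d → EuclideanSpace ℝ (Fin d) → ℝ),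
      MemW1p Ω p.conjExponent φ Dφ →
        ∫ x in Ω, ∑ i, Du i x * Dφ i x = -∫ x in Ω, g x * φ x

/-- `Ψ^0, …, Ψ^N` solves the backward implicit Euler scheme with time step `τ`, diffusion
coefficient `m` and right-hand side `F^1, …, F^N ∈ L^p(Ω)`:
`(Ψ^{k+1} - Ψ^k) / τ + m Δ Ψ^k = F^{k+1}` and `∂ₙ Ψ^k = 0` for `0 ≤ k < N`, and `Ψ^N = 0`;
here `L^k = Δ Ψ^k`. -/
structure IsDiscreteSolution {d : ℕ} (Ω : Set (EuclideanSpace ℝ (Fin d))) (p m τ : ℝ) (N : ℕ)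
    (F Ψ L : ℕ → EuclideanSpace ℝ (Fin d) → ℝ) : Prop where
  memLp_rhs : ∀ k < N, MemLp (F (k + 1)) (ENNReal.ofReal p) (volume.restrict Ω)
  laplacian : ∀ k < N, HasNeumannLaplacian Ω p (Ψ k) (L k)
  scheme : ∀ k < N, ∀ᵐ x ∂volume.restrict Ω,
    (Ψ (k + 1) x - Ψ k x) / τ + m * L k x = F (k + 1) x
  final : ∀ᵐ x ∂volume.restrict Ω, Ψ N x = 0

/-- The norm `(∑_{k<N} τ ‖G^k‖_{L^p(Ω)}^p)^{1/p}` of `G^0, …, G^{N-1}` in `ℓ^p(L^p)`. -/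
noncomputable def discreteNorm {d : ℕ} (Ω : Set (EuclideanSpace ℝ (Fin d))) (p τ : ℝ) (N : ℕ)
    (G : ℕ → EuclideanSpace ℝ (Fin d) → ℝ) : ℝ≥0∞ :=
  (∑ k ∈ Finset.range N, ENNReal.ofReal τ *
    eLpNorm (G k) (ENNReal.ofReal p) (volume.restrict Ω) ^ p) ^ (1 / p)

/-- The discrete maximal regularity estimate holds with the constant `C`, for `N` steps of
length `τ`. -/
def DiscreteMaxRegBound {d : ℕ} (Ω : Set (EuclideanSpace ℝ (Fin d))) (p m τ : ℝ) (N : ℕ)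
    (C : ℝ≥0) : Prop :=
  ∀ F Ψ L : ℕ → EuclideanSpace ℝ (Fin d) → ℝ, IsDiscreteSolution Ω p m τ N F Ψ L →
    discreteNorm Ω p τ N L ≤ (C : ℝ≥0∞) * discreteNorm Ω p τ N (fun k => F (k + 1))

/-- The discrete maximal regularity constant `K_{m,p}` of `Ω`: the best constant valid for all time
steps `τ > 0` and all numbers of steps `N` (it is `∞` if there is no such constant). -/
noncomputable def discreteMaxRegConst {d : ℕ} (Ω : Set (EuclideanSpace ℝ (Fin d))) (m p : ℝ) :
    ℝ≥0∞ :=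
  ⨅ (C : ℝ≥0) (_ : ∀ τ : ℝ, 0 < τ → ∀ N : ℕ, DiscreteMaxRegBound Ω p m τ N C), (C : ℝ≥0∞)

/-! Scaling in `m` is a change of time unit: replacing `(m, τ, F)` by `(mc, τ/c, cF)` keeps `Ψ` and
`ΔΨ`. The new time step puts the same factor on both norms, so only the factor `c` of `F` changes
the constant. Applying this with `c` and with `1/c` gives equality (`discreteMaxRegConst_eq_div`).

For `p = 2`, square the scheme and integrate. The term `‖(Ψ^{k+1} - Ψ^k)/τ‖²` is dropped, and
Green's formula bounds the cross term below by `(m/τ)(‖∇Ψ^k‖² - ‖∇Ψ^{k+1}‖²)` (`energy_step`). The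
sum over `k` telescopes to a nonnegative quantity because `Ψ^N = 0`, hence `C = 1/m` works.

For sharpness, let `Ψ^0` be a bump concentrated at a small scale inside `Ω` and all other `Ψ^k`
zero. Then `F^1 = mΔΨ^0 - Ψ^0/τ` is dominated by `mΔΨ^0`, and the ratio of the norms tends to `1/m`,
for any fixed `τ` and `N ≥ 1`. -/

/-! ### Change of time unit and dependence on `m`. -/

section Rescaling

variable {d : ℕ} {Ω : Set (EuclideanSpace ℝ (Fin d))} {p m τ c : ℝ} {N : ℕ}

/-- Multiplying the diffusion coefficient and the right-hand side by `c` and dividing the time step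
by `c` preserves solutions. -/
theorem IsDiscreteSolution.rescale {F Ψ L : ℕ → EuclideanSpace ℝ (Fin d) → ℝ}
    (h : IsDiscreteSolution Ω p m τ N F Ψ L) (c : ℝ) :
    IsDiscreteSolution Ω p (m * c) (τ / c) N (fun k x => c * F k x) Ψ L where
  memLp_rhs k hk := (h.memLp_rhs k hk).const_mul c
  laplacian := h.laplacian
  scheme k hk := by
    filter_upwards [h.scheme k hk] with x hx
    rw [← hx, div_div_eq_mul_div]
    ring
  final := h.final

theorem discreteNorm_div_step (hc : 0 < c) (G : ℕ → EuclideanSpace ℝ (Fin d) → ℝ) (hp : 0 ≤ p) :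
    discreteNorm Ω p (τ / c) N G = ENNReal.ofReal c⁻¹ ^ (1 / p) * discreteNorm Ω p τ N G := by
  unfold discreteNorm
  rw [← ENNReal.mul_rpow_of_nonneg _ _ (by positivity), Finset.mul_sum]
  congr 1
  refine Finset.sum_congr rfl fun k _ => ?_
  rw [← mul_assoc, ← ENNReal.ofReal_mul (by positivity), div_eq_inv_mul]

theorem discreteNorm_const_mul (hc : 0 ≤ c) (G : ℕ → EuclideanSpace ℝ (Fin d) → ℝ) (hp : 0 < p) :
    discreteNorm Ω p τ N (fun k x => c * G k x) = ENNReal.ofReal c * discreteNorm Ω p τ N G := by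
  unfold discreteNorm
  have h : ∀ k, eLpNorm (fun x => c * G k x) (ENNReal.ofReal p) (volume.restrict Ω) =
      ENNReal.ofReal c * eLpNorm (G k) (ENNReal.ofReal p) (volume.restrict Ω) := fun k => by
    rw [← Real.enorm_of_nonneg hc]
    exact eLpNorm_const_smul c (G k) _ _
  have hpow : ENNReal.ofReal c = (ENNReal.ofReal c ^ p) ^ (1 / p) := by
    rw [← ENNReal.rpow_mul, mul_one_div_cancel hp.ne', ENNReal.rpow_one]
  conv_rhs => rw [hpow]
  rw [← ENNReal.mul_rpow_of_nonneg _ _ (by positivity), Finset.mul_sum]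
  congr 1
  refine Finset.sum_congr rfl fun k _ => ?_
  rw [h, ENNReal.mul_rpow_of_nonneg _ _ hp.le]
  ring

theorem DiscreteMaxRegBound.rescale {C : ℝ≥0} (h : DiscreteMaxRegBound Ω p m τ N C) (hp : 0 < p)
    (hc : 0 < c) : DiscreteMaxRegBound Ω p (m * c) (τ / c) N (C / c.toNNReal) := by
  intro F Ψ L hs
  have hs' := hs.rescale c⁻¹
  rw [mul_assoc, mul_inv_cancel₀ hc.ne', mul_one, div_inv_eq_mul, div_mul_cancel₀ _ hc.ne'] at hs'
  have key := h _ _ _ hs'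
  rw [discreteNorm_const_mul (by positivity) (fun k => F (k + 1)) hp] at key
  rw [discreteNorm_div_step hc _ hp.le, discreteNorm_div_step hc _ hp.le]
  have hC : ((C / c.toNNReal : ℝ≥0) : ℝ≥0∞) = C * ENNReal.ofReal c⁻¹ := by
    rw [ENNReal.coe_div (by simpa using hc), ENNReal.ofReal_inv_of_pos hc, div_eq_mul_inv]
    rfl
  rw [hC]
  calc _ ≤ ENNReal.ofReal c⁻¹ ^ (1 / p) *
        (C * (ENNReal.ofReal c⁻¹ * discreteNorm Ω p τ N fun k => F (k + 1))) := by gcongr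
    _ = _ := by ring

theorem discreteMaxRegConst_mul_le (hp : 0 < p) (hc : 0 < c) :
    discreteMaxRegConst Ω (m * c) p ≤ discreteMaxRegConst Ω m p / ENNReal.ofReal c := by
  have hc0 : ENNReal.ofReal c ≠ 0 := by simpa using hc
  rw [ENNReal.le_div_iff_mul_le (.inl hc0) (.inl ENNReal.ofReal_ne_top)]
  refine le_iInf₂ fun C hC => ?_
  have hle : discreteMaxRegConst Ω (m * c) p ≤ ((C / c.toNNReal : ℝ≥0) : ℝ≥0∞) :=
    -- A step `τ` for the coefficient `m * c` comes from the step `τ * c` for `m`, so the bound is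
    -- needed at all steps.
    iInf₂_le _ fun τ hτ N => by
      simpa [mul_div_cancel_right₀ τ hc.ne'] using (hC (τ * c) (by positivity) N).rescale hp hc
  rwa [ENNReal.coe_div (by simpa using hc), ← ENNReal.ofReal,
    ENNReal.le_div_iff_mul_le (.inl hc0) (.inl ENNReal.ofReal_ne_top)] at hle

theorem discreteMaxRegConst_eq_div (hp : 0 < p) (hm : 0 < m) :
    discreteMaxRegConst Ω m p = discreteMaxRegConst Ω 1 p / ENNReal.ofReal m := by
  refine le_antisymm (by simpa using discreteMaxRegConst_mul_le (Ω := Ω) (m := 1) hp hm) ?_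
  -- The reverse inequality is the same estimate, starting from `m` with factor `1/m`.
  have h := discreteMaxRegConst_mul_le (Ω := Ω) (m := m) hp (inv_pos.2 hm)
  rw [mul_inv_cancel₀ hm.ne', ENNReal.ofReal_inv_of_pos hm, div_eq_mul_inv, inv_inv] at h
  exact ENNReal.div_le_of_le_mul h

end Rescaling

/-! ### Energy estimate for `p = 2`. -/

section Energy

variable {d : ℕ} {Ω : Set (EuclideanSpace ℝ (Fin d))} {m τ : ℝ} {N : ℕ}

theorem eLpNorm_two_rpow_two {α : Type*} [MeasurableSpace α] {μ : Measure α} {f : α → ℝ}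
    (hf : MemLp f 2 μ) : eLpNorm f 2 μ ^ (2 : ℝ) = ENNReal.ofReal (∫ x, f x ^ 2 ∂μ) := by
  rw [hf.eLpNorm_eq_integral_rpow_norm two_ne_zero ENNReal.ofNat_ne_top,
    ENNReal.ofReal_rpow_of_nonneg (by positivity) (by norm_num), ← Real.rpow_mul (by positivity)]
  simp

theorem discreteNorm_two_eq (hτ : 0 ≤ τ) {G : ℕ → EuclideanSpace ℝ (Fin d) → ℝ}
    (hG : ∀ k < N, MemLp (G k) 2 (volume.restrict Ω)) :
    discreteNorm Ω 2 τ N G =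
      ENNReal.ofReal (τ * ∑ k ∈ Finset.range N, ∫ x in Ω, G k x ^ 2) ^ (1 / 2 : ℝ) := by
  unfold discreteNorm
  rw [Finset.mul_sum, ENNReal.ofReal_sum_of_nonneg fun k _ => by positivity]
  congr 1
  refine Finset.sum_congr rfl fun k hk => ?_
  rw [ENNReal.ofReal_mul hτ, ENNReal.ofReal_ofNat,
    eLpNorm_two_rpow_two (hG k (Finset.mem_range.1 hk))]

theorem discreteNorm_two_le_iff (hτ : 0 < τ) {G H : ℕ → EuclideanSpace ℝ (Fin d) → ℝ}
    (hG : ∀ k < N, MemLp (G k) 2 (volume.restrict Ω))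
    (hH : ∀ k < N, MemLp (H k) 2 (volume.restrict Ω)) (C : ℝ≥0) :
    discreteNorm Ω 2 τ N G ≤ C * discreteNorm Ω 2 τ N H ↔
      ∑ k ∈ Finset.range N, ∫ x in Ω, G k x ^ 2 ≤
        (C : ℝ) ^ 2 * ∑ k ∈ Finset.range N, ∫ x in Ω, H k x ^ 2 := by
  have hC : (C : ℝ≥0∞) = ENNReal.ofReal ((C : ℝ) ^ 2) ^ (1 / 2 : ℝ) := by
    rw [ENNReal.ofReal_rpow_of_nonneg (by positivity) (by norm_num), ← Real.sqrt_eq_rpow,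
      Real.sqrt_sq C.coe_nonneg, ENNReal.ofReal_coe_nnreal]
  rw [discreteNorm_two_eq hτ.le hG, discreteNorm_two_eq hτ.le hH, hC,
    ← ENNReal.mul_rpow_of_nonneg _ _ (by norm_num), ENNReal.rpow_le_rpow_iff (by norm_num),
    ← ENNReal.ofReal_mul (by positivity), ENNReal.ofReal_le_ofReal_iff (by positivity),
    mul_left_comm, mul_le_mul_iff_right₀ hτ]

theorem HasNeumannLaplacian.memLp {p : ℝ} {u g : EuclideanSpace ℝ (Fin d) → ℝ}
    (h : HasNeumannLaplacian Ω p u g) : MemLp g (ENNReal.ofReal p) (volume.restrict Ω) := by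
  obtain ⟨Du, D2u, hu, hg, -⟩ := h
  refine (memLp_finsetSum Finset.univ fun i _ =>
    (hu.memW1p_partial i).memLp_partial i).ae_eq ?_
  filter_upwards [hg] with x hx using by rw [hx]

/-- Meant for `Ψ^N`, which is only known to vanish almost everywhere: it becomes admissible in
Green's formula, with a gradient that is exactly zero at the end of the telescoping sum. -/
theorem memW1p_zero_gradient_of_ae_eq_zero {p : ℝ} {u : EuclideanSpace ℝ (Fin d) → ℝ}
    (hu : ∀ᵐ x ∂volume.restrict Ω, u x = 0) : MemW1p Ω p u 0 where
  memLp := (MemLp.zero' (ε := ℝ)).ae_eq (by filter_upwards [hu] with x hx using hx.symm)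
  memLp_partial _ := MemLp.zero
  hasWeakPartial i φ _ _ _ := by
    have : (fun x => u x * fderiv ℝ φ x (EuclideanSpace.single i 1)) =ᵐ[volume.restrict Ω] 0 := by
      filter_upwards [hu] with x hx using by simp [hx]
    simp [integral_congr_ae this]

/-- The gradients of a solution, with Green's formula in `L²`. -/
theorem IsDiscreteSolution.exists_gradient {F Ψ L : ℕ → EuclideanSpace ℝ (Fin d) → ℝ}
    (h : IsDiscreteSolution Ω 2 m τ N F Ψ L) :
    ∃ D : ℕ → Fin d → EuclideanSpace ℝ (Fin d) → ℝ,
      (∀ k ≤ N, MemW1p Ω 2 (Ψ k) (D k)) ∧ D N = 0 ∧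
      ∀ k < N, ∀ φ Dφ, MemW1p Ω 2 φ Dφ →
        ∫ x in Ω, ∑ i, D k i x * Dφ i x = -∫ x in Ω, L k x * φ x := by
  have key : ∀ k, ∃ Dk : Fin d → EuclideanSpace ℝ (Fin d) → ℝ,
      (k ≤ N → MemW1p Ω 2 (Ψ k) Dk) ∧ (k = N → Dk = 0) ∧
      (k < N → ∀ φ Dφ, MemW1p Ω 2 φ Dφ →
        ∫ x in Ω, ∑ i, Dk i x * Dφ i x = -∫ x in Ω, L k x * φ x) := by
    intro k
    rcases lt_trichotomy k N with hk | rfl | hk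
    · obtain ⟨Du, D2u, hu, -, hg⟩ := h.laplacian k hk
      -- Since 2 is its own conjugate exponent, the `Ψ^k` themselves are admissible test functions.
      have h2 : (2 : ℝ).conjExponent = 2 := by norm_num [Real.conjExponent]
      rw [h2] at hg
      exact ⟨Du, fun _ => hu.memW1p, fun h => absurd h hk.ne, fun _ => hg⟩
    · exact ⟨0, fun _ => memW1p_zero_gradient_of_ae_eq_zero h.final, fun _ => rfl,
        fun h => absurd h (lt_irrefl _)⟩
    · exact ⟨0, fun h => absurd hk h.not_gt, fun _ => rfl, fun h => absurd hk h.not_gt⟩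
  choose D h1 h2 h3 using key
  exact ⟨D, h1, h2 N rfl, h3⟩

/-- The energy estimate of one time step: `A`, `B` are the gradients of `u = Ψ^k`, `v = Ψ^{k+1}`. -/
theorem energy_step {α : Type*} [MeasurableSpace α] {μ : Measure α} {u v f g : α → ℝ}
    {A B : Fin d → α → ℝ} (hm : 0 ≤ m) (hτ : 0 < τ)
    (hu : MemLp u 2 μ) (hv : MemLp v 2 μ) (hf : MemLp f 2 μ) (hg : MemLp g 2 μ)
    (hA : ∀ i, MemLp (A i) 2 μ) (hB : ∀ i, MemLp (B i) 2 μ)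
    (heq : ∀ᵐ x ∂μ, (v x - u x) / τ + m * g x = f x)
    (hgu : ∫ x, ∑ i, A i x * A i x ∂μ = -∫ x, g x * u x ∂μ)
    (hgv : ∫ x, ∑ i, A i x * B i x ∂μ = -∫ x, g x * v x ∂μ) :
    m ^ 2 * ∫ x, g x ^ 2 ∂μ + m / τ * (∫ x, ∑ i, A i x ^ 2 ∂μ - ∫ x, ∑ i, B i x ^ 2 ∂μ) ≤
      ∫ x, f x ^ 2 ∂μ := by
  have iAA : Integrable (fun x => ∑ i, A i x ^ 2) μ :=
    integrable_finsetSum _ fun i _ => (hA i).integrable_sq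
  have iBB : Integrable (fun x => ∑ i, B i x ^ 2) μ :=
    integrable_finsetSum _ fun i _ => (hB i).integrable_sq
  have iAB : Integrable (fun x => ∑ i, A i x * B i x) μ :=
    integrable_finsetSum _ fun i _ => (hA i).integrable_mul (hB i)
  have igu : Integrable (fun x => g x * u x) μ := hg.integrable_mul hu
  have igv : Integrable (fun x => g x * v x) μ := hg.integrable_mul hv
  have hdiff : Integrable (fun x => g x * v x - g x * u x) μ := igv.sub igu
  have hAB : 2 * ∫ x, ∑ i, A i x * B i x ∂μ ≤
      ∫ x, ∑ i, A i x ^ 2 ∂μ + ∫ x, ∑ i, B i x ^ 2 ∂μ := by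
    rw [← integral_const_mul, ← integral_add iAA iBB]
    refine integral_mono (iAB.const_mul 2) (iAA.add iBB) fun x => ?_
    dsimp only
    rw [Finset.mul_sum, ← Finset.sum_add_distrib]
    exact Finset.sum_le_sum fun i _ => by nlinarith [sq_nonneg (A i x - B i x)]
  have hF : m ^ 2 * ∫ x, g x ^ 2 ∂μ + 2 * m / τ * (∫ x, g x * v x ∂μ - ∫ x, g x * u x ∂μ) ≤
      ∫ x, f x ^ 2 ∂μ := by
    rw [← integral_sub igv igu, ← integral_const_mul, ← integral_const_mul,
      ← integral_add (hg.integrable_sq.const_mul _) (hdiff.const_mul _)]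
    refine integral_mono_ae ((hg.integrable_sq.const_mul _).add (hdiff.const_mul _))
      hf.integrable_sq ?_
    filter_upwards [heq] with x hx
    rw [← hx, ← sub_nonneg]
    have : ((v x - u x) / τ + m * g x) ^ 2 -
        (m ^ 2 * g x ^ 2 + 2 * m / τ * (g x * v x - g x * u x)) = ((v x - u x) / τ) ^ 2 := by
      ring
    simpa only [Pi.add_apply, this] using sq_nonneg ((v x - u x) / τ)
  simp only [← pow_two] at hgu
  -- Subtracting the two Green formulas gives `∫ g(v - u) = ∫ |A|² - ∫ A·B`; by `hAB`, twice this is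
  -- at least `∫ |A|² - ∫ |B|²`.
  refine le_trans ?_ hF
  have hmτ : 0 ≤ m / τ := by positivity
  have : 2 * m / τ * (∫ x, g x * v x ∂μ - ∫ x, g x * u x ∂μ) =
      m / τ * (2 * (∫ x, g x * v x ∂μ - ∫ x, g x * u x ∂μ)) := by ring
  rw [this]
  gcongr
  linarith

theorem discreteMaxRegBound_two_of_le (hm : 0 < m) (hτ : 0 < τ) (N : ℕ) {C : ℝ≥0}
    (hC : 1 / m ≤ (C : ℝ)) : DiscreteMaxRegBound Ω 2 m τ N C := by
  intro F Ψ L h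
  have hF : ∀ k < N, MemLp (F (k + 1)) 2 (volume.restrict Ω) := by
    simpa only [ENNReal.ofReal_ofNat] using h.memLp_rhs
  have hL : ∀ k < N, MemLp (L k) 2 (volume.restrict Ω) := fun k hk => by
    simpa only [ENNReal.ofReal_ofNat] using (h.laplacian k hk).memLp
  rw [discreteNorm_two_le_iff hτ hL hF]
  obtain ⟨D, hD, hDN, hgreen⟩ := h.exists_gradient
  have hΨ : ∀ k ≤ N, MemLp (Ψ k) 2 (volume.restrict Ω) := fun k hk => by
    simpa only [ENNReal.ofReal_ofNat] using (hD k hk).memLp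
  have hD2 : ∀ k ≤ N, ∀ i, MemLp (D k i) 2 (volume.restrict Ω) := fun k hk => by
    simpa only [ENNReal.ofReal_ofNat] using (hD k hk).memLp_partial
  have hsum := Finset.sum_le_sum fun k (hk : k ∈ Finset.range N) =>
    have hk := Finset.mem_range.1 hk
    energy_step hm.le hτ (hΨ k hk.le) (hΨ (k + 1) hk) (hF k hk) (hL k hk) (hD2 k hk.le)
      (hD2 (k + 1) hk) (h.scheme k hk) (hgreen k hk _ _ (hD k hk.le))
      (hgreen k hk _ _ (hD (k + 1) hk))
  rw [Finset.sum_add_distrib, ← Finset.mul_sum, ← Finset.mul_sum,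
    Finset.sum_range_sub' fun k => ∫ x in Ω, ∑ i, D k i x ^ 2] at hsum
  simp only [hDN, Pi.zero_apply, ne_eq, OfNat.ofNat_ne_zero, not_false_eq_true, zero_pow,
    Finset.sum_const_zero, integral_zero, sub_zero] at hsum
  have hE : 0 ≤ m / τ * ∫ x in Ω, ∑ i, D 0 i x ^ 2 := by positivity
  have hmC : 1 ≤ (C : ℝ) * m := (div_le_iff₀ hm).1 hC
  set S := ∑ k ∈ Finset.range N, ∫ x in Ω, L k x ^ 2 with hS
  have hS0 : 0 ≤ S := by positivity
  calc S ≤ ((C : ℝ) * m) ^ 2 * S := le_mul_of_one_le_left hS0 (one_le_pow₀ hmC)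
    _ = (C : ℝ) ^ 2 * (m ^ 2 * S) := by ring
    _ ≤ _ := by gcongr; linarith

end Energy

/-! ### Smooth compactly supported functions: Neumann condition, scaling, nonvanishing Laplacian. -/

section TestFunctions

variable {d : ℕ} {Ω : Set (EuclideanSpace ℝ (Fin d))}

/-- The partial derivative `∂ᵢ u`. -/
noncomputable def partialDeriv (i : Fin d) (u : EuclideanSpace ℝ (Fin d) → ℝ) :
    EuclideanSpace ℝ (Fin d) → ℝ :=
  fun x => fderiv ℝ u x (EuclideanSpace.single i 1)

/-- The Laplacian `∑ᵢ ∂ᵢ ∂ᵢ u`. -/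
noncomputable def coordLaplacian (u : EuclideanSpace ℝ (Fin d) → ℝ) :
    EuclideanSpace ℝ (Fin d) → ℝ :=
  fun x => ∑ i, partialDeriv i (partialDeriv i u) x

theorem ContDiff.partialDeriv {u : EuclideanSpace ℝ (Fin d) → ℝ} (hu : ContDiff ℝ ∞ u)
    (i : Fin d) : ContDiff ℝ ∞ (partialDeriv i u) :=
  (hu.fderiv_right (m := ∞) le_rfl).clm_apply contDiff_const

theorem ContDiff.coordLaplacian {u : EuclideanSpace ℝ (Fin d) → ℝ} (hu : ContDiff ℝ ∞ u) :
    ContDiff ℝ ∞ (coordLaplacian u) :=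
  ContDiff.sum fun i _ => (hu.partialDeriv i).partialDeriv i

theorem tsupport_partialDeriv_subset (i : Fin d) (u : EuclideanSpace ℝ (Fin d) → ℝ) :
    tsupport (partialDeriv i u) ⊆ tsupport u :=
  tsupport_fderiv_apply_subset ℝ _

theorem HasCompactSupport.partialDeriv {u : EuclideanSpace ℝ (Fin d) → ℝ}
    (hu : HasCompactSupport u) (i : Fin d) : HasCompactSupport (partialDeriv i u) :=
  hu.fderiv_apply ℝ _

theorem coordLaplacian_eq_zero_of_notMem {u : EuclideanSpace ℝ (Fin d) → ℝ}
    {x : EuclideanSpace ℝ (Fin d)} (hx : x ∉ tsupport u) : coordLaplacian u x = 0 :=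
  Finset.sum_eq_zero fun i _ => image_eq_zero_of_notMem_tsupport fun h =>
    hx (tsupport_partialDeriv_subset i u (tsupport_partialDeriv_subset i _ h))

theorem HasCompactSupport.coordLaplacian {u : EuclideanSpace ℝ (Fin d) → ℝ}
    (hu : HasCompactSupport u) : HasCompactSupport (coordLaplacian u) :=
  .intro hu fun _ hx => coordLaplacian_eq_zero_of_notMem hx

theorem integral_mul_partialDeriv {u v : EuclideanSpace ℝ (Fin d) → ℝ} (hu : ContDiff ℝ ∞ u)
    (hv : ContDiff ℝ ∞ v) (hvc : HasCompactSupport v) (i : Fin d) :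
    ∫ x, u x * partialDeriv i v x = -∫ x, partialDeriv i u x * v x := by
  have hi : ∀ {f g : EuclideanSpace ℝ (Fin d) → ℝ}, ContDiff ℝ ∞ f → ContDiff ℝ ∞ g →
      HasCompactSupport g → Integrable fun x => f x * g x := fun hf hg hgc =>
    (hf.continuous.mul hg.continuous).integrable_of_hasCompactSupport hgc.mul_left
  exact integral_mul_fderiv_eq_neg_fderiv_mul_of_integrable (hi (hu.partialDeriv i) hv hvc)
    (hi hu (hv.partialDeriv i) (hvc.partialDeriv i)) (hi hu hv hvc)
    (fun x _ => hu.differentiable (by simp) x) (fun x _ => hv.differentiable (by simp) x)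

theorem memW1p_of_contDiff {p : ℝ} {u : EuclideanSpace ℝ (Fin d) → ℝ} (hu : ContDiff ℝ ∞ u)
    (huc : HasCompactSupport u) : MemW1p Ω p u (fun i => partialDeriv i u) where
  memLp := (hu.continuous.memLp_of_hasCompactSupport huc).restrict Ω
  memLp_partial i :=
    ((hu.partialDeriv i).continuous.memLp_of_hasCompactSupport (huc.partialDeriv i)).restrict Ω
  hasWeakPartial i φ hφ hφc hφΩ := by
    rw [setIntegral_eq_integral_of_forall_compl_eq_zero,
      setIntegral_eq_integral_of_forall_compl_eq_zero]
    · exact integral_mul_partialDeriv hu hφ hφc i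
    · intro x hx
      rw [image_eq_zero_of_notMem_tsupport fun h => hx (hφΩ h), mul_zero]
    · intro x hx
      have : partialDeriv i φ x = 0 :=
        image_eq_zero_of_notMem_tsupport fun h => hx (hφΩ (tsupport_partialDeriv_subset i φ h))
      exact mul_eq_zero_of_right _ this

/-- Test functions satisfy the homogeneous Neumann condition. -/
theorem hasNeumannLaplacian_of_contDiff {p : ℝ} (hp : 1 < p)
    {u : EuclideanSpace ℝ (Fin d) → ℝ} (hu : ContDiff ℝ ∞ u) (huc : HasCompactSupport u)
    (huΩ : tsupport u ⊆ Ω) : HasNeumannLaplacian Ω p u (coordLaplacian u) := by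
  refine ⟨fun i => partialDeriv i u, fun i j => partialDeriv j (partialDeriv i u),
    ⟨memW1p_of_contDiff hu huc, fun i => memW1p_of_contDiff (hu.partialDeriv i)
      (huc.partialDeriv i)⟩, .of_forall fun x => rfl, fun φ Dφ hφ => ?_⟩
  have := (Real.HolderConjugate.conjExponent hp).ennrealOfReal
  have hmem : ∀ {v : EuclideanSpace ℝ (Fin d) → ℝ}, ContDiff ℝ ∞ v → HasCompactSupport v →
      MemLp v (ENNReal.ofReal p) (volume.restrict Ω) := fun hv hvc =>
    (hv.continuous.memLp_of_hasCompactSupport hvc).restrict Ω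
  have hu2 := fun i => (hu.partialDeriv i).partialDeriv i
  have huc2 := fun i => (huc.partialDeriv i).partialDeriv i
  simp only [coordLaplacian, Finset.sum_mul]
  rw [integral_finsetSum, integral_finsetSum, ← Finset.sum_neg_distrib]
  · refine Finset.sum_congr rfl fun i _ => ?_
    -- The roles are swapped: `∂ᵢ u` is the test function in the definition of the weak derivative
    -- of `φ`, so no boundary regularity is needed.
    have h := hφ.hasWeakPartial i _ (hu.partialDeriv i) (huc.partialDeriv i)
      ((tsupport_partialDeriv_subset i u).trans huΩ)
    simp only [mul_comm (partialDeriv i u _), mul_comm (partialDeriv i (partialDeriv i u) _)]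
    exact neg_eq_iff_eq_neg.1 h.symm
  · exact fun i _ => (hmem (hu2 i) (huc2 i)).integrable_mul hφ.memLp
  · exact fun i _ => (hmem (hu.partialDeriv i) (huc.partialDeriv i)).integrable_mul
      (hφ.memLp_partial i)

theorem partialDeriv_const_mul_comp (i : Fin d) (u : EuclideanSpace ℝ (Fin d) → ℝ) (a R : ℝ)
    (x₀ : EuclideanSpace ℝ (Fin d)) (hu : ContDiff ℝ ∞ u) :
    partialDeriv i (fun x => a * u (R • (x - x₀))) =
      fun x => a * R * partialDeriv i u (R • (x - x₀)) := by
  ext x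
  have h1 : HasFDerivAt (fun x => R • (x - x₀))
      (R • ContinuousLinearMap.id ℝ (EuclideanSpace ℝ (Fin d))) x :=
    ((hasFDerivAt_id x).sub_const x₀).const_smul R
  have h2 := ((hu.differentiable (by simp) (R • (x - x₀))).hasFDerivAt.comp x h1).const_mul a
  have h3 := h2.fderiv
  simp only [Function.comp_def] at h3
  simp [partialDeriv, h3, mul_assoc]

theorem coordLaplacian_comp (u : EuclideanSpace ℝ (Fin d) → ℝ) (R : ℝ)
    (x₀ : EuclideanSpace ℝ (Fin d)) (hu : ContDiff ℝ ∞ u) :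
    coordLaplacian (fun x => u (R • (x - x₀))) =
      fun x => R ^ 2 * coordLaplacian u (R • (x - x₀)) := by
  ext x
  simp only [coordLaplacian, Finset.mul_sum]
  refine Finset.sum_congr rfl fun i _ => ?_
  have h := partialDeriv_const_mul_comp i u 1 R x₀ hu
  simp only [one_mul] at h
  rw [h, partialDeriv_const_mul_comp i _ R R x₀ (hu.partialDeriv i), pow_two]

theorem integral_comp_smul_sub (f : EuclideanSpace ℝ (Fin d) → ℝ) (R : ℝ)
    (x₀ : EuclideanSpace ℝ (Fin d)) :
    ∫ x, f (R • (x - x₀)) = |(R ^ d)⁻¹| * ∫ x, f x := by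
  rw [integral_sub_right_eq_self fun x => f (R • x), Measure.integral_comp_smul]
  simp

/-- If `Δu = 0`, integrating `uΔu` by parts gives `∇u = 0`, so `u` is constant; compact support then
forces `u = 0`, because the space is noncompact when `d ≥ 1`. -/
theorem integral_coordLaplacian_sq_pos {u : EuclideanSpace ℝ (Fin d) → ℝ} (hd : 1 ≤ d)
    (hu : ContDiff ℝ ∞ u) (huc : HasCompactSupport u) (hu0 : u ≠ 0) :
    0 < ∫ x, coordLaplacian u x ^ 2 := by
  have hpos : ∀ {v : EuclideanSpace ℝ (Fin d) → ℝ} {x}, ContDiff ℝ ∞ v → HasCompactSupport v →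
      v x ≠ 0 → 0 < ∫ x, v x ^ 2 := fun {v x} hv hvc hx =>
    (hv.continuous.pow 2).integral_pos_of_hasCompactSupport_nonneg_nonzero (x := x)
      (hvc.comp_left (g := fun t : ℝ => t ^ 2) (by simp)) (fun x => sq_nonneg (v x))
      (pow_ne_zero 2 hx)
  by_contra hL
  have hL0 : ∀ x, coordLaplacian u x = 0 := fun x => by
    by_contra hx
    exact hL (hpos hu.coordLaplacian huc.coordLaplacian hx)
  have hsum : ∑ i, ∫ x, partialDeriv i u x ^ 2 = 0 := by
    have h1 : ∀ i, ∫ x, partialDeriv i u x ^ 2 =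
        -∫ x, partialDeriv i (partialDeriv i u) x * u x := fun i => by
      rw [← integral_mul_partialDeriv (hu.partialDeriv i) hu huc i]
      simp only [pow_two]
    rw [Finset.sum_congr rfl fun i _ => h1 i, Finset.sum_neg_distrib, ← integral_finsetSum]
    · simp only [← Finset.sum_mul]
      have : ∀ x, (∑ i, partialDeriv i (partialDeriv i u) x) * u x = 0 := fun x =>
        mul_eq_zero_of_left (hL0 x) _
      simp [this]
    · exact fun i _ => (((hu.partialDeriv i).partialDeriv i).continuous.mul
        hu.continuous).integrable_of_hasCompactSupport huc.mul_left
  have hD : ∀ i x, partialDeriv i u x = 0 := fun i x => by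
    by_contra hx
    refine (hpos (hu.partialDeriv i) (huc.partialDeriv i) hx).ne' ?_
    exact (Finset.sum_eq_zero_iff_of_nonneg fun i _ => by positivity).1 hsum i (Finset.mem_univ i)
  have hfd : ∀ x, fderiv ℝ u x = 0 := fun x => by
    refine ContinuousLinearMap.coe_injective
      ((EuclideanSpace.basisFun (Fin d) ℝ).toBasis.ext fun i => ?_)
    simpa [partialDeriv] using hD i x
  have : Nonempty (Fin d) := ⟨⟨0, hd⟩⟩
  have : NoncompactSpace (EuclideanSpace ℝ (Fin d)) := NormedSpace.noncompactSpace ℝ _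
  obtain ⟨y, hy⟩ := (Set.ne_univ_iff_exists_notMem _).1 huc.isCompact.ne_univ
  refine hu0 (funext fun x => ?_)
  rw [is_const_of_fderiv_eq_zero (hu.differentiable (by simp)) hfd x y,
    image_eq_zero_of_notMem_tsupport hy, Pi.zero_apply]

end TestFunctions

/-! ### Lower bound by concentrating bumps. -/

section Sharpness

variable {d : ℕ} {Ω : Set (EuclideanSpace ℝ (Fin d))} {m τ : ℝ} {N : ℕ}

/-- A test function `u` yields a solution with `Ψ^0 = u` and `Ψ^k = 0` for `k ≥ 1`. -/
theorem DiscreteMaxRegBound.integral_coordLaplacian_sq_le {C : ℝ≥0} (hτ : 0 < τ) (hN : 1 ≤ N)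
    (h : DiscreteMaxRegBound Ω 2 m τ N C) {u : EuclideanSpace ℝ (Fin d) → ℝ}
    (hu : ContDiff ℝ ∞ u) (huc : HasCompactSupport u) (huΩ : tsupport u ⊆ Ω) :
    ∫ x, coordLaplacian u x ^ 2 ≤ (C : ℝ) ^ 2 * ∫ x, (m * coordLaplacian u x - u x / τ) ^ 2 := by
  set f : EuclideanSpace ℝ (Fin d) → ℝ := fun x => m * coordLaplacian u x - u x / τ with hf
  have hfmem : MemLp f 2 (volume.restrict Ω) :=
    ((((hu.coordLaplacian.continuous.memLp_of_hasCompactSupport huc.coordLaplacian).const_mul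
      m).sub ((hu.continuous.memLp_of_hasCompactSupport huc).mul_const τ⁻¹))).restrict Ω
  have hLmem : MemLp (coordLaplacian u) 2 (volume.restrict Ω) :=
    (hu.coordLaplacian.continuous.memLp_of_hasCompactSupport huc.coordLaplacian).restrict Ω
  have hsol : IsDiscreteSolution Ω 2 m τ N (fun k => if k = 1 then f else 0)
      (fun k => if k = 0 then u else 0) (fun k => if k = 0 then coordLaplacian u else 0) := by
    refine ⟨fun k _ => ?_, fun k _ => ?_, fun k _ => .of_forall fun x => ?_, ?_⟩
    · split_ifs
      · simpa using hfmem
      · exact MemLp.zero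
    · split_ifs
      · exact hasNeumannLaplacian_of_contDiff one_lt_two hu huc huΩ
      · have h0 : coordLaplacian (0 : EuclideanSpace ℝ (Fin d) → ℝ) = 0 := by
          ext x; exact coordLaplacian_eq_zero_of_notMem (by simp)
        have := hasNeumannLaplacian_of_contDiff (Ω := Ω) one_lt_two
          (u := (0 : EuclideanSpace ℝ (Fin d) → ℝ)) contDiff_const HasCompactSupport.zero (by simp)
        rwa [h0] at this
    · by_cases hk : k = 0
      · simp only [hk, hf]; simp; ring
      · simp [hk]
    · simp [Nat.one_le_iff_ne_zero.1 hN]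
  have hle := h _ _ _ hsol
  rw [discreteNorm_two_le_iff hτ] at hle
  · rw [Finset.sum_eq_single_of_mem 0 (by simp; omega) (fun k _ hk => by simp [hk]),
      Finset.sum_eq_single_of_mem 0 (by simp; omega) (fun k _ hk => by simp [hk])] at hle
    simp only [if_true, zero_add] at hle
    rwa [setIntegral_eq_integral_of_forall_compl_eq_zero,
      setIntegral_eq_integral_of_forall_compl_eq_zero] at hle
    · intro x hx
      simp [hf, coordLaplacian_eq_zero_of_notMem fun h => hx (huΩ h),
        image_eq_zero_of_notMem_tsupport fun h => hx (huΩ h)]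
    · intro x hx
      simp [coordLaplacian_eq_zero_of_notMem fun h => hx (huΩ h)]
  · intro k _
    split_ifs
    · exact hLmem
    · exact MemLp.zero
  · intro k _
    split_ifs
    · exact hfmem
    · exact MemLp.zero

theorem DiscreteMaxRegBound.one_div_le {C : ℝ≥0} (hd : 1 ≤ d) (hΩ : IsOpen Ω) (hne : Ω.Nonempty)
    (hm : 0 < m) (hτ : 0 < τ) (hN : 1 ≤ N) (h : DiscreteMaxRegBound Ω 2 m τ N C) :
    1 / m ≤ (C : ℝ) := by
  obtain ⟨x₀, hx₀⟩ := hne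
  obtain ⟨ε, hε, hball⟩ := Metric.nhds_basis_closedBall.mem_iff.1 (hΩ.mem_nhds hx₀)
  let η : ContDiffBump (0 : EuclideanSpace ℝ (Fin d)) := ⟨1, 2, one_pos, one_lt_two⟩
  have hη : ContDiff ℝ ∞ η := η.contDiff
  have hηc : HasCompactSupport η := η.hasCompactSupport
  have hη0 : (η : EuclideanSpace ℝ (Fin d) → ℝ) ≠ 0 := fun h0 => by
    have h1 : η 0 = 1 := η.one_of_mem_closedBall (by simp [η])
    simp [h0] at h1
  have hpos := integral_coordLaplacian_sq_pos hd hη hηc hη0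
  -- The bump has outer radius 2, so `R > 2 / ε` puts the support of `η (R • (x - x₀))` inside the
  -- ball of radius `ε`. The Jacobian cancels, and division by `R ^ 4` leaves the terms containing
  -- `η` itself with negative powers of `R`.
  have hscaled : ∀ R : ℝ, 2 / ε < R → ∫ x, coordLaplacian η x ^ 2 ≤
      (C : ℝ) ^ 2 * (m ^ 2 * (∫ x, coordLaplacian η x ^ 2) -
        2 * m / τ * (∫ x, coordLaplacian η x * η x) * R⁻¹ ^ 2 +
          (1 / τ ^ 2) * (∫ x, η x ^ 2) * (R⁻¹ ^ 2) ^ 2) := by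
    intro R hR
    have hR0 : 0 < R := lt_trans (by positivity) hR
    have hsupp : Function.support (fun x => η (R • (x - x₀))) ⊆ Metric.closedBall x₀ ε := by
      intro x hx
      have : R • (x - x₀) ∈ Function.support η := hx
      rw [η.support_eq, mem_ball_zero_iff, norm_smul, Real.norm_of_nonneg hR0.le] at this
      rw [mem_closedBall_iff_norm]
      have h2 : 2 < R * ε := (div_lt_iff₀ hε).1 hR
      have h3 : R * ‖x - x₀‖ < R * ε := lt_trans this h2
      exact (lt_of_mul_lt_mul_left h3 hR0.le).le
    have hle := h.integral_coordLaplacian_sq_le hτ hN (u := fun x => η (R • (x - x₀)))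
      (hη.comp ((contDiff_id.sub contDiff_const).const_smul R))
      (.of_support_subset_isCompact (isCompact_closedBall x₀ ε) hsupp)
      ((closure_minimal hsupp Metric.isClosed_closedBall).trans hball)
    rw [coordLaplacian_comp _ R x₀ hη,
      integral_comp_smul_sub (fun y => (R ^ 2 * coordLaplacian η y) ^ 2) R x₀,
      integral_comp_smul_sub (fun y => (m * (R ^ 2 * coordLaplacian η y) - η y / τ) ^ 2) R x₀,
      mul_left_comm, mul_le_mul_iff_right₀ (by positivity)] at hle
    have hLc := hη.coordLaplacian.continuous
    have e1 : ∫ x, (R ^ 2 * coordLaplacian η x) ^ 2 = R ^ 4 * ∫ x, coordLaplacian η x ^ 2 := by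
      rw [← integral_const_mul]
      congr 1; ext x; ring
    have i1 : Integrable fun x => coordLaplacian η x ^ 2 :=
      (hLc.memLp_of_hasCompactSupport hηc.coordLaplacian).integrable_sq
    have i2 : Integrable fun x => coordLaplacian η x * η x :=
      (hLc.mul hη.continuous).integrable_of_hasCompactSupport hηc.mul_left
    have i3 : Integrable fun x => η x ^ 2 :=
      (hη.continuous.memLp_of_hasCompactSupport hηc).integrable_sq
    have e2 : ∫ x, (m * (R ^ 2 * coordLaplacian η x) - η x / τ) ^ 2 =
        m ^ 2 * R ^ 4 * (∫ x, coordLaplacian η x ^ 2) -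
          2 * m * R ^ 2 / τ * (∫ x, coordLaplacian η x * η x) + 1 / τ ^ 2 * ∫ x, η x ^ 2 := by
      rw [← integral_const_mul, ← integral_const_mul, ← integral_const_mul,
        ← integral_sub (i1.const_mul _) (i2.const_mul _), ← integral_add (f := fun x =>
          m ^ 2 * R ^ 4 * coordLaplacian η x ^ 2 - 2 * m * R ^ 2 / τ * (coordLaplacian η x * η x))
          ((i1.const_mul _).sub (i2.const_mul _)) (i3.const_mul _)]
      congr 1; ext x; ring
    rw [e1, e2] at hle
    refine le_of_mul_le_mul_left (hle.trans_eq ?_) (pow_pos hR0 4)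
    field_simp
  have htend : Filter.Tendsto (fun R : ℝ => R⁻¹ ^ 2) Filter.atTop (nhds 0) := by
    simpa only [ne_eq, OfNat.ofNat_ne_zero, not_false_eq_true, zero_pow] using
      (tendsto_inv_atTop_zero (𝕜 := ℝ)).pow 2
  have hlim := (((htend.const_mul
    (2 * m / τ * (∫ x, coordLaplacian η x * η x))).const_sub
      (m ^ 2 * (∫ x, coordLaplacian η x ^ 2))).add
        ((htend.pow 2).const_mul ((1 / τ ^ 2) * (∫ x, η x ^ 2)))).const_mul ((C : ℝ) ^ 2)
  -- As `R → ∞` only `∫ (Δη)² ≤ C² m² ∫ (Δη)²` remains, and the integral is positive.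
  have hfin := ge_of_tendsto hlim
    ((Filter.eventually_gt_atTop (2 / ε)).mono fun R hR => hscaled R hR)
  simp only [mul_zero, sub_zero, ne_eq, OfNat.ofNat_ne_zero, not_false_eq_true, zero_pow,
    add_zero, ← mul_assoc] at hfin
  rw [div_le_iff₀ hm]
  have h1 : 1 ≤ (C : ℝ) ^ 2 * m ^ 2 := le_of_mul_le_mul_right (by rwa [one_mul]) hpos
  rw [← mul_pow] at h1
  exact (one_le_sq_iff₀ (by positivity)).1 h1

theorem discreteMaxRegBound_two_iff {C : ℝ≥0} (hd : 1 ≤ d) (hΩ : IsOpen Ω) (hne : Ω.Nonempty)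
    (hm : 0 < m) (hτ : 0 < τ) (hN : 1 ≤ N) :
    DiscreteMaxRegBound Ω 2 m τ N C ↔ 1 / m ≤ (C : ℝ) :=
  ⟨fun h => h.one_div_le hd hΩ hne hm hτ hN, discreteMaxRegBound_two_of_le hm hτ N⟩

theorem discreteMaxRegConst_two (hd : 1 ≤ d) (hΩ : IsOpen Ω) (hne : Ω.Nonempty) (hm : 0 < m) :
    discreteMaxRegConst Ω m 2 = ENNReal.ofReal (1 / m) := by
  refine le_antisymm (iInf₂_le _ fun τ hτ N => discreteMaxRegBound_two_of_le hm hτ N ?_)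
    (le_iInf₂ fun C hC => ?_)
  · exact Real.le_coe_toNNReal _
  · rw [ENNReal.ofReal_le_coe]
    -- A single step of length 1 already forces the lower bound.
    exact (hC 1 one_pos 1).one_div_le hd hΩ hne hm one_pos le_rfl

end Sharpness

theorem mainTheorem4 {d : ℕ} (hd : 1 ≤ d) {Ω : Set (EuclideanSpace ℝ (Fin d))}
    (hΩ : IsSmoothDomain Ω) {m : ℝ} (hm : 0 < m) :
    (∀ p : ℝ, 1 < p →
      discreteMaxRegConst Ω m p = discreteMaxRegConst Ω 1 p / ENNReal.ofReal m) ∧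
    discreteMaxRegConst Ω m 2 = ENNReal.ofReal (1 / m) ∧
    (∀ τ : ℝ, 0 < τ → ∀ N : ℕ, 1 ≤ N → ∀ C : ℝ≥0,
      DiscreteMaxRegBound Ω 2 m τ N C ↔ 1 / m ≤ (C : ℝ)) :=
  ⟨fun _ hp => discreteMaxRegConst_eq_div (zero_lt_one.trans hp) hm,
    discreteMaxRegConst_two hd hΩ.isOpen hΩ.isConnected.nonempty hm,
    fun _ hτ _ hN _ =>
      discreteMaxRegBound_two_iff hd hΩ.isOpen hΩ.isConnected.nonempty hm hτ hN⟩
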